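/- For a finite group $G$, the commuting conjugacy class graph $\mathcal{CCC}(G)$ is the simple graph whose vertices are the conjugacy classes of the non-central elements of $G$, two distinct classes $x^G$ and $y^G$ being adjacent if and only if some $x'\in x^G$ commutes with some $y'\in y^G$. For a finite simple graph $\Gamma$ with vertex set $v(\Gamma)$ and edge set $e(\Gamma)$, put $M_1(\Gamma)=\sum_{v\in v(\Gamma)}\deg(v)^2$ and $M_2(\Gamma)=\sum_{uv\in e(\Gamma)}\deg(u)\deg(v)$. Write $lK_n$ for the disjoint union of $l$ copies of the complete graph $K_n$. Theorem. Let $p$ be a prime and let $G$ be a finite group with centre $Z(G)$ such that $G/Z(G)$ is non-abelian of order $p^3$. Put $$x=|Z(G)|,\qquad m=\frac{x(p^2-1)}{p},\qquad n_1=\frac{x(p-1)}{p^2},\qquad n_2=\frac{x(p-1)}{p}.$$ Then $\mathcal{CCC}(G)$ is isomorphic to at least one of the following graphs (where those of the numbers $m,n_1,n_2$ that occur in the graph in question are integers): 1. $K_m\sqcup kp\,K_{n_1}\sqcup (p-k)K_{n_2}$ for some integer $k$ with $1\le k\le p$; 2. $(kp+1)K_{n_1}\sqcup (p+1-k)K_{n_2}$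 for some integer $k$ with $1\le k\le p$; 3. $K_m\sqcup p\,K_{n_2}$; 4. $(p^2+p+1)K_{n_1}$; 5. $K_{n_1}\sqcup (p+1)K_{n_2}$. Moreover, $\mathcal{CCC}(G)$ has at least one edge, and it satisfies the Hansen–Vukičević inequality strictly: $$\frac{M_2(\mathcal{CCC}(G))}{|e(\mathcal{CCC}(G))|}>\frac{M_1(\mathcal{CCC}(G))}{|v(\mathcal{CCC}(G))|}.$$ -/

import Mathlib

open scoped SimpleGraph

/-- The conjugacy classes of the non-central elements of `G`: the vertices of the commuting
conjugacy class graph. -/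
def NoncentralClass (G : Type*) [Group G] : Type _ :=
  {c : ConjClasses G // ∃ x : G, x ∉ Subgroup.center G ∧ ConjClasses.mk x = c}

noncomputable instance NoncentralClass.instFintype (G : Type*) [Group G] [Finite G] :
    Fintype (NoncentralClass G) :=
  haveI : Finite (ConjClasses G) := Finite.of_surjective ConjClasses.mk ConjClasses.mk_surjective
  haveI : Finite (NoncentralClass G) := Subtype.finite
  Fintype.ofFinite _

/-- The commuting conjugacy class graph of `G`: two distinct classes of non-central elements are
joined if and only if some element of the first commutes with some element of the second. -/
def CCC (G : Type*) [Group G] : SimpleGraph (NoncentralClass G) where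
  Adj c d := c ≠ d ∧ ∃ x ∈ c.1.carrier, ∃ y ∈ d.1.carrier, x * y = y * x
  symm := ⟨fun _ _ ⟨hne, x, hx, y, hy, hxy⟩ => ⟨hne.symm, y, hy, x, hx, hxy.symm⟩⟩
  loopless := ⟨fun _ h => h.1 rfl⟩

/-- The graph `l K_n`, the disjoint union of `l` copies of the complete graph on `n` vertices. -/
def copiesOfComplete (l n : ℕ) : SimpleGraph (Fin l × Fin n) where
  Adj u v := u.1 = v.1 ∧ u.2 ≠ v.2
  symm := ⟨fun _ _ h => ⟨h.1.symm, h.2.symm⟩⟩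
  loopless := ⟨fun _ h => h.2 rfl⟩

open Classical in
/-- The first Zagreb index: the sum of `deg(v)²` over all vertices. -/
noncomputable def firstZagreb {V : Type*} [Fintype V] (Γ : SimpleGraph V) : ℕ :=
  ∑ v : V, Γ.degree v ^ 2

open Classical in
/-- The second Zagreb index: the sum of `deg(u) deg(v)` over all edges `uv`. -/
noncomputable def secondZagreb {V : Type*} [Fintype V] (Γ : SimpleGraph V) : ℕ :=
  ∑ e ∈ Γ.edgeFinset, Sym2.lift ⟨fun u v => Γ.degree u * Γ.degree v, fun _ _ => mul_comm _ _⟩ e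

/-!
Let `Z = Z(G)`, let `Z₂` be the second centre, and let `x = |Z|`. A subgroup containing `Z` has order
`p ^ i * x` with `i ≤ 3`, so a chain of such subgroups has at most three strict inclusions. This
makes commuting transitive on non-central elements (`commute_of_mem_centralizer`), hence `CCC G` is a
disjoint union of complete graphs, one for each class of the relation "containing commuting
elements". It also gives `|Z₂| = p * x`, and `Z₂ ≤ C(t)` for every `t ∈ Z₂ \ Z`.

Fix such a `t`. As `G ⧸ Z₂` is abelian, `C(t)` is normal, so the component of `t` consists of the
classes inside `C(t) \ Z`. For `y ∉ C(t)` the chain `Z < C(y) < H < G`, with `H` the group of elements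
commuting with `y` modulo `Z`, has maximal length; so `|C(y)| = p * x` and `|H| = p ^ 2 * x`. Moreover
the elements with a conjugate in `C(y) \ Z` are exactly those of `H \ Z₂`
(`exists_conj_mem_centralizer_iff`). Since the class of an element `w` has `|G| / |C(w)|` elements,
counting group elements gives the numbers of vertices of all components
(`card_special_class_mul`, `mul_card_other_class`), and then the number of components
(`card_other_vertices_mul`).

Only two graphs remain: `|C(t)| = p * x` gives `K_{n₁} ⊔ (p + 1) K_{n₂}`, and `|C(t)| = p ^ 2 * x`
gives `K_m ⊔ p K_{n₂}`. In both, adjacent vertices have equal degrees, so that with `d` the degree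
function `2 * M₂ = ∑ d ^ 3` and `2 * |e| = ∑ d`. The inequality becomes
`(∑ d ^ 2) * (∑ d) < |v| * ∑ d ^ 3`, which is strict as soon as `d` is not constant
(`hansen_vukicevic_strict`); here the two sizes of complete components differ.
-/

/-! ### Centralizers when the central quotient is non-abelian of order `p ^ 3` -/

section GroupTheory

open Subgroup

variable {G : Type*} [Group G]

/-- The elements of `G` that commute with `y` modulo the centre, as a subgroup of `G`. -/
def centralizerModCenter (y : G) : Subgroup G :=
  (centralizer {(y : G ⧸ center G)}).comap (QuotientGroup.mk' (center G))

/-- The second centre of `G`: the elements that are central modulo the centre. -/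
def secondCenter (G : Type*) [Group G] : Subgroup G :=
  (center (G ⧸ center G)).comap (QuotientGroup.mk' (center G))

theorem mem_centralizerModCenter {w y : G} :
    w ∈ centralizerModCenter y ↔ (w : G ⧸ center G) * y = y * w := by
  simp [centralizerModCenter, mem_centralizer_singleton_iff]

theorem mem_secondCenter {w : G} :
    w ∈ secondCenter G ↔ ∀ y : G, (y : G ⧸ center G) * w = w * y := by
  simp only [secondCenter, mem_comap, mem_center_iff, QuotientGroup.mk'_apply]
  exact ⟨fun h y => h y, fun h y => QuotientGroup.induction_on y h⟩

instance secondCenter_normal : (secondCenter G).Normal :=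
  inferInstanceAs ((center (G ⧸ center G)).comap (QuotientGroup.mk' (center G))).Normal

theorem center_le_centralizer_singleton (y : G) : center G ≤ centralizer {y} :=
  center_le_centralizer _

theorem center_le_secondCenter : center G ≤ secondCenter G := fun w hw => by
  have : (w : G ⧸ center G) = 1 := (QuotientGroup.eq_one_iff w).2 hw
  simp [mem_secondCenter, this]

theorem centralizer_le_centralizerModCenter (y : G) :
    centralizer {y} ≤ centralizerModCenter y := fun w hw => by
  rw [mem_centralizerModCenter, ← QuotientGroup.mk_mul, mem_centralizer_singleton_iff.1 hw,
    QuotientGroup.mk_mul]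

theorem secondCenter_le_centralizerModCenter (y : G) :
    secondCenter G ≤ centralizerModCenter y := fun w hw => by
  rw [mem_centralizerModCenter, mem_secondCenter.1 hw]

theorem centralizerModCenter_lt_top {y : G} (hy : y ∉ secondCenter G) :
    centralizerModCenter y < ⊤ := by
  rw [lt_top_iff_ne_top]
  refine fun h => hy (mem_secondCenter.2 fun w => ?_)
  exact mem_centralizerModCenter.1 (h ▸ mem_top w)

theorem centralizer_lt_top {y : G} (hy : y ∉ center G) : centralizer {y} < ⊤ := by
  rw [lt_top_iff_ne_top]
  refine fun h => hy (mem_center_iff.2 fun w => ?_)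
  exact mem_centralizer_singleton_iff.1 (h ▸ mem_top w)

theorem center_lt_centralizer {y : G} (hy : y ∉ center G) : center G < centralizer {y} :=
  SetLike.lt_iff_le_and_exists.2
    ⟨center_le_centralizer _, y, mem_centralizer_singleton_iff.2 rfl, hy⟩

variable {p : ℕ} (hp : p.Prime) (hcard : Nat.card (G ⧸ center G) = p ^ 3)
include hcard

theorem card_eq_pow_three_mul_card_center :
    Nat.card G = p ^ 3 * Nat.card (center G) := by
  rw [← hcard, ← (center G).card_mul_index, mul_comm]; rfl

include hp

theorem exists_card_eq_pow_mul_card_center {H : Subgroup G} (hH : center G ≤ H) :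
    ∃ i, Nat.card H = p ^ i * Nat.card (center G) := by
  have h1 : (center G).relIndex H ∣ p ^ 3 := hcard ▸ relIndex_dvd_index_of_le hH
  obtain ⟨i, -, hi⟩ := (Nat.dvd_prime_pow hp).1 h1
  refine ⟨i, ?_⟩
  have h2 := relIndex_mul_relIndex (⊥ : Subgroup G) (center G) H bot_le hH
  rw [relIndex_bot_left, relIndex_bot_left, hi] at h2
  rw [← h2, mul_comm]

variable [Finite G]

/-- Above the centre, orders of subgroups at least multiply by `p` along strict inclusions;
since the index of the centre is `p ^ 3`, chains above the centre are short. -/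
theorem mul_card_le_card_of_lt {H K : Subgroup G} (hH : center G ≤ H) (hHK : H < K) :
    p * Nat.card H ≤ Nat.card K := by
  obtain ⟨i, hi⟩ := exists_card_eq_pow_mul_card_center hp hcard hH
  obtain ⟨j, hj⟩ := exists_card_eq_pow_mul_card_center hp hcard (hH.trans hHK.le)
  have hlt : Nat.card H < Nat.card K := Set.ncard_lt_ncard hHK (Set.toFinite _)
  rw [hi, hj] at hlt ⊢
  have hij : i < j := (Nat.pow_lt_pow_iff_right hp.one_lt).1 (lt_of_mul_lt_mul_right' hlt)
  rw [← mul_assoc, ← pow_succ']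
  exact Nat.mul_le_mul_right _ (Nat.pow_le_pow_right hp.pos hij)

/-- Two elements commuting with a common non-central element commute: otherwise there would be a
chain of four strict inclusions of subgroups from the centre to `G`. -/
theorem commute_of_mem_centralizer {g a b : G} (hg : g ∉ center G) (ha : a ∈ centralizer {g})
    (hb : b ∈ centralizer {g}) : a * b = b * a := by
  by_contra hab
  have hZ : ∀ y : G, center G ≤ centralizer {y} := fun y => center_le_centralizer _
  rw [mem_centralizer_singleton_iff] at ha hb
  have h1 := mul_card_le_card_of_lt hp hcard (H := center G)
    (K := centralizer {g} ⊓ centralizer {a} ⊓ centralizer {b}) le_rfl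
    (SetLike.lt_iff_le_and_exists.2 ⟨le_inf (le_inf (hZ _) (hZ _)) (hZ _), g,
      by simp [mem_inf, mem_centralizer_singleton_iff, ha, hb], hg⟩)
  have h2 := mul_card_le_card_of_lt hp hcard (H := centralizer {g} ⊓ centralizer {a} ⊓
      centralizer {b}) (K := centralizer {g} ⊓ centralizer {a})
    (le_inf (le_inf (hZ _) (hZ _)) (hZ _))
    (SetLike.lt_iff_le_and_exists.2 ⟨inf_le_left, a,
      by simp [mem_inf, mem_centralizer_singleton_iff, ha],
      by simp [mem_inf, mem_centralizer_singleton_iff, hab]⟩)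
  have h3 := mul_card_le_card_of_lt hp hcard (H := centralizer {g} ⊓ centralizer {a})
    (K := centralizer {g}) (le_inf (hZ _) (hZ _))
    (SetLike.lt_iff_le_and_exists.2 ⟨inf_le_left, b,
      by simp [mem_centralizer_singleton_iff, hb],
      by simp [mem_inf, mem_centralizer_singleton_iff, Ne.symm hab]⟩)
  have h4 := mul_card_le_card_of_lt hp hcard (hZ g) (centralizer_lt_top hg)
  rw [card_top, card_eq_pow_three_mul_card_center hcard] at h4
  have hx : 0 < Nat.card (center G) := Nat.card_pos
  have h5 : p * (p * (p * (p * Nat.card (center G)))) ≤ p ^ 3 * Nat.card (center G) :=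
    (Nat.mul_le_mul_left p ((Nat.mul_le_mul_left p
      ((Nat.mul_le_mul_left p h1).trans h2)).trans h3)).trans h4
  have h6 : p ^ 3 * Nat.card (center G) * p ≤ p ^ 3 * Nat.card (center G) * 1 := by
    linarith
  have := Nat.le_of_mul_le_mul_left h6 (by have := hp.pos; positivity)
  exact absurd hp.one_lt (by omega)

variable (hnonab : ¬ ∀ a b : G ⧸ center G, a * b = b * a)
include hnonab

theorem center_lt_secondCenter : center G < secondCenter G := by
  have : Fact p.Prime := ⟨hp⟩
  have : Nontrivial (G ⧸ center G) := by
    by_contra h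
    rw [not_nontrivial_iff_subsingleton] at h
    exact hnonab fun a b => Subsingleton.elim _ _
  have := (IsPGroup.of_card hcard).center_nontrivial
  obtain ⟨c, hc⟩ := exists_ne (1 : center (G ⧸ center G))
  obtain ⟨t, ht⟩ := QuotientGroup.mk_surjective c.1
  refine SetLike.lt_iff_le_and_exists.2 ⟨center_le_secondCenter, t, ?_, fun h => hc ?_⟩
  · rw [secondCenter, mem_comap, QuotientGroup.mk'_apply, ht]
    exact c.2
  · rw [← QuotientGroup.eq_one_iff, ht] at h
    exact Subtype.ext h

theorem card_secondCenter : Nat.card (secondCenter G) = p * Nat.card (center G) := by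
  refine le_antisymm ?_ (mul_card_le_card_of_lt hp hcard le_rfl
    (center_lt_secondCenter hp hcard hnonab))
  obtain ⟨a, ha⟩ : ∃ a : G, a ∉ secondCenter G := by
    by_contra! h
    refine hnonab fun x y => QuotientGroup.induction_on x fun x => ?_
    exact mem_center_iff.1 (mem_comap.1 (h x)) y |>.symm
  have h1 := mul_card_le_card_of_lt hp hcard center_le_secondCenter (K := centralizerModCenter a)
    (SetLike.lt_iff_le_and_exists.2 ⟨secondCenter_le_centralizerModCenter a, a,
      mem_centralizerModCenter.2 rfl, ha⟩)
  have h2 := mul_card_le_card_of_lt hp hcard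
    (center_le_secondCenter.trans (secondCenter_le_centralizerModCenter a))
    (centralizerModCenter_lt_top ha)
  rw [card_top, card_eq_pow_three_mul_card_center hcard] at h2
  have h3 := (Nat.mul_le_mul_left p h1).trans h2
  refine Nat.le_of_mul_le_mul_left (c := p * p) ?_ (Nat.mul_pos hp.pos hp.pos)
  linarith

/-- The quotient by the second centre has order `p ^ 2`, so it is abelian. -/
theorem commutator_mem_secondCenter (a b : G) : a * b * a⁻¹ * b⁻¹ ∈ secondCenter G := by
  have : Fact p.Prime := ⟨hp⟩
  have h2 : Nat.card (G ⧸ secondCenter G) = p ^ 2 := by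
    have h := (secondCenter G).card_mul_index
    rw [card_eq_pow_three_mul_card_center hcard, card_secondCenter hp hcard hnonab] at h
    refine Nat.eq_of_mul_eq_mul_left
      (show 0 < p * Nat.card (center G) from Nat.mul_pos hp.pos Nat.card_pos) (h.trans ?_)
    ring
  have hc := (IsPGroup.isMulCommutative_of_card_eq_prime_sq h2).is_comm.comm
    (a : G ⧸ secondCenter G) b
  rw [← QuotientGroup.eq_one_iff]
  simp only [QuotientGroup.mk_mul, QuotientGroup.mk_inv, hc]
  group

theorem normal_of_secondCenter_le {H : Subgroup G} (hH : secondCenter G ≤ H) : H.Normal :=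
  ⟨fun h hh g => by
    simpa using H.mul_mem (hH (commutator_mem_secondCenter hp hcard hnonab g h)) hh⟩

/-- Modulo the centre, the conjugates of an element `w` outside the second centre fill a coset of
the second centre: `g ↦ [g, w]` is a homomorphism modulo the centre, and its image is a nontrivial
subgroup of a group of order `p`. -/
theorem exists_conj_eq_mul {w z : G} (hw : w ∉ secondCenter G) (hz : z ∈ secondCenter G) :
    ∃ g : G, ((g * w * g⁻¹ : G) : G ⧸ center G) = (z * w : G) := by
  let φ : G →* G ⧸ center G :=
    MonoidHom.mk' (fun g => ((g * w * g⁻¹ * w⁻¹ : G) : G ⧸ center G)) (by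
    intro a b
    have hb := mem_secondCenter.1 (commutator_mem_secondCenter hp hcard hnonab b w)
    calc ((a * b * w * (a * b)⁻¹ * w⁻¹ : G) : G ⧸ center G)
        = (a * (b * w * b⁻¹ * w⁻¹ : G) : G ⧸ center G) * (w * a⁻¹ * w⁻¹ : G) := by
          rw [← QuotientGroup.mk_mul, ← QuotientGroup.mk_mul]; congr 1; group
      _ = ((b * w * b⁻¹ * w⁻¹ : G) : G ⧸ center G) * (a * w * a⁻¹ * w⁻¹ : G) := by
          rw [hb a, mul_assoc, ← QuotientGroup.mk_mul, ← mul_assoc, ← mul_assoc]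
      _ = _ := (hb _).symm)
  have hφ : φ.range.comap (QuotientGroup.mk' (center G)) ≤ secondCenter G := by
    rintro d ⟨g, hg⟩
    have hg' : ((g * w * g⁻¹ * w⁻¹ : G) : G ⧸ center G) = d := hg
    rw [mem_secondCenter, ← hg']
    exact mem_secondCenter.1 (commutator_mem_secondCenter hp hcard hnonab g w)
  have h1 := mul_card_le_card_of_lt hp hcard (H := center G)
    (K := φ.range.comap (QuotientGroup.mk' (center G))) le_rfl <| by
      have hle : center G ≤ φ.range.comap (QuotientGroup.mk' (center G)) := fun c hc => by
        rw [mem_comap, QuotientGroup.mk'_apply, (QuotientGroup.eq_one_iff c).2 hc]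
        exact one_mem _
      refine lt_of_le_of_ne hle fun heq => hw (mem_secondCenter.2 fun g => ?_)
      have hg : g * w * g⁻¹ * w⁻¹ ∈ center G := heq ▸ mem_comap.2 ⟨g, rfl⟩
      rw [← QuotientGroup.eq_one_iff] at hg
      simpa [mul_inv_eq_iff_eq_mul] using hg
  rw [← card_secondCenter hp hcard hnonab] at h1
  rw [← eq_of_le_of_card_ge hφ h1] at hz
  obtain ⟨g, hg⟩ := hz
  have hg' : ((g * w * g⁻¹ * w⁻¹ : G) : G ⧸ center G) = z := hg
  refine ⟨g, ?_⟩
  rw [QuotientGroup.mk_mul _ z w, ← hg', ← QuotientGroup.mk_mul, inv_mul_cancel_right]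

/-- Modulo the centre, the second centre has prime order and is therefore generated by `t`. -/
theorem secondCenter_le_centralizer {t : G} (ht : t ∈ secondCenter G) (htZ : t ∉ center G) :
    secondCenter G ≤ centralizer {t} := by
  have h1 := mul_card_le_card_of_lt hp hcard (H := center G)
    (K := secondCenter G ⊓ centralizer {t}) le_rfl
    (SetLike.lt_iff_le_and_exists.2 ⟨le_inf center_le_secondCenter (center_le_centralizer _), t,
      mem_inf.2 ⟨ht, mem_centralizer_singleton_iff.2 rfl⟩, htZ⟩)
  rw [← card_secondCenter hp hcard hnonab] at h1
  exact inf_eq_left.1 (eq_of_le_of_card_ge inf_le_left h1)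

variable {t : G} (ht : t ∈ secondCenter G)
include ht

/-- A common non-central element `w` of `C(y)` and the second centre would commute with both `y` and
`t`, which then would commute with each other. -/
theorem centralizer_inf_secondCenter {y : G} (hy : y ∉ centralizer {t}) {w : G}
    (hw : w ∈ centralizer {y}) (hw2 : w ∈ secondCenter G) : w ∈ center G := by
  by_contra hwZ
  have htw := secondCenter_le_centralizer hp hcard hnonab hw2 hwZ ht
  rw [mem_centralizer_singleton_iff] at hw
  have hyw : y ∈ centralizer {w} := mem_centralizer_singleton_iff.2 hw.symm
  exact hy (mem_centralizer_singleton_iff.2 (commute_of_mem_centralizer hp hcard hwZ hyw htw))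

variable (htZ : t ∉ center G)
include htZ

/-- An element outside the centralizer of the second centre lies in the chain
`Z(G) < C(y) < C(y mod Z(G)) < G`, which has the maximal length, so all the orders are known. -/
theorem card_centralizer_of_notMem {y : G} (hy : y ∉ centralizer {t}) :
    Nat.card (centralizer {y}) = p * Nat.card (center G) ∧
      Nat.card (centralizerModCenter y) = p ^ 2 * Nat.card (center G) := by
  have hyZ : y ∉ center G := fun h => hy (center_le_centralizer _ h)
  have hy2 : y ∉ secondCenter G := fun h => hy (secondCenter_le_centralizer hp hcard hnonab ht htZ h)
  have h1 := mul_card_le_card_of_lt hp hcard le_rfl (center_lt_centralizer hyZ)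
  have h2 := mul_card_le_card_of_lt hp hcard (center_le_centralizer _)
    (SetLike.lt_iff_le_and_exists.2 ⟨centralizer_le_centralizerModCenter y, t,
      secondCenter_le_centralizerModCenter y ht, fun h => hy (mem_centralizer_singleton_iff.2
        (mem_centralizer_singleton_iff.1 h).symm)⟩)
  have h3 := mul_card_le_card_of_lt hp hcard
    ((center_le_centralizer _).trans (centralizer_le_centralizerModCenter y))
    (centralizerModCenter_lt_top hy2)
  rw [card_top, card_eq_pow_three_mul_card_center hcard] at h3
  have h4 : Nat.card (centralizerModCenter y) ≤ p ^ 2 * Nat.card (center G) :=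
    Nat.le_of_mul_le_mul_left (c := p) (by linarith) hp.pos
  have h5 : Nat.card (centralizer {y}) ≤ p * Nat.card (center G) :=
    Nat.le_of_mul_le_mul_left (c := p) (by linarith) hp.pos
  refine ⟨le_antisymm h5 h1, le_antisymm h4 ?_⟩
  linarith [Nat.mul_le_mul_left p h1]

/-- The non-central elements with a conjugate commuting with `y` form the set `H \ Z₂(G)`, where `H`
consists of the elements commuting with `y` modulo the centre. Indeed `H = C(y) Z₂(G)`, and a
conjugation can absorb the factor from the second centre. -/
theorem exists_conj_mem_centralizer_iff {y : G} (hy : y ∉ centralizer {t}) {w : G} :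
    (w ∉ center G ∧ ∃ g, g * w * g⁻¹ ∈ centralizer {y}) ↔
      w ∈ centralizerModCenter y ∧ w ∉ secondCenter G := by
  have hyZ : y ∉ center G := fun h => hy (center_le_centralizer _ h)
  have hn := normal_of_secondCenter_le hp hcard hnonab (secondCenter_le_centralizerModCenter y)
  constructor
  · rintro ⟨hw, g, hg⟩
    constructor
    · simpa [mul_assoc] using
        hn.conj_mem _ (centralizer_le_centralizerModCenter y hg) g⁻¹
    · intro hw2
      have := centralizer_inf_secondCenter hp hcard hnonab ht hy hg
        (secondCenter_normal.conj_mem _ hw2 g)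
      have h3 := (inferInstance : (center G).Normal).conj_mem _ this g⁻¹
      exact hw (by simpa [mul_assoc] using h3)
  · rintro ⟨hw, hw2⟩
    refine ⟨fun h => hw2 (center_le_secondCenter h), ?_⟩
    obtain ⟨hcy, hcH⟩ := card_centralizer_of_notMem hp hcard hnonab ht htZ hy
    have hsup : centralizer {y} ⊔ secondCenter G = centralizerModCenter y := by
      refine eq_of_le_of_card_ge (sup_le (centralizer_le_centralizerModCenter y)
        (secondCenter_le_centralizerModCenter y)) ?_
      have := mul_card_le_card_of_lt hp hcard (center_le_centralizer _)
        (H := centralizer {y}) (K := centralizer {y} ⊔ secondCenter G)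
        (SetLike.lt_iff_le_and_exists.2 ⟨le_sup_left, t, mem_sup_right ht, fun h => hy
          (mem_centralizer_singleton_iff.2 (mem_centralizer_singleton_iff.1 h).symm)⟩)
      rwa [hcH, pow_two, mul_assoc, ← hcy]
    rw [← hsup, mem_sup_of_normal_right] at hw
    obtain ⟨c, hc, z, hz, rfl⟩ := hw
    obtain ⟨g, hg⟩ := exists_conj_eq_mul hp hcard hnonab hw2 (inv_mem hz)
    refine ⟨g, ?_⟩
    -- modulo the centre the conjugate is `c`, hence it differs from `c` by a central factor
    have hzc := mem_secondCenter.1 hz c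
    have h5 : ((c : G) : G ⧸ center G) = (g * (c * z) * g⁻¹ : G) := by
      rw [hg, QuotientGroup.mk_mul, QuotientGroup.mk_mul, hzc, QuotientGroup.mk_inv,
        inv_mul_cancel_left]
    have h6 := mul_mem hc (center_le_centralizer {y} (QuotientGroup.eq.1 h5))
    rwa [mul_inv_cancel_left] at h6

end GroupTheory

/-! ### Zagreb indices and disjoint unions of complete graphs -/

section GraphTheory

variable {V : Type*}

open Classical in
/-- Summing `deg(u) deg(v)` over darts counts each edge twice; grouped by the first endpoint, the
sum is `∑ deg(v)³` as the two endpoints of an edge have equal degrees. -/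
theorem two_mul_secondZagreb_eq_sum [Fintype V] {Γ : SimpleGraph V}
    (h : ∀ u v, Γ.Adj u v → Γ.degree u = Γ.degree v) :
    2 * secondZagreb Γ = ∑ v, Γ.degree v ^ 3 := by
  have h1 : ∑ d : Γ.Dart, Γ.degree d.fst ^ 2 = ∑ v, Γ.degree v ^ 3 := by
    rw [← Finset.sum_fiberwise Finset.univ (fun d : Γ.Dart => d.fst)]
    refine Finset.sum_congr rfl fun v _ => ?_
    rw [Finset.sum_congr rfl (g := fun _ => Γ.degree v ^ 2) (fun d hd => by
      rw [(Finset.mem_filter.1 hd).2]), Finset.sum_const, Γ.dart_fst_fiber_card_eq_degree,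
      smul_eq_mul, ← pow_succ']
  rw [← h1, secondZagreb, Finset.mul_sum,
    ← Finset.sum_fiberwise_of_maps_to (s := Finset.univ) (t := Γ.edgeFinset)
      (g := fun d : Γ.Dart => d.edge) (fun d _ => SimpleGraph.mem_edgeFinset.2 d.edge_mem)]
  refine Finset.sum_congr rfl fun e he => ?_
  rw [Finset.sum_eq_card_nsmul fun d hd => ?_,
    Γ.dart_edge_fiber_card e (SimpleGraph.mem_edgeFinset.1 he), smul_eq_mul]
  rw [← (Finset.mem_filter.1 hd).2]
  change Γ.degree d.fst ^ 2 = Γ.degree d.fst * Γ.degree d.snd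
  rw [← h _ _ d.adj, sq]

/-- Symmetrizing, `2 (|ι| ∑ d³ - ∑ d² ∑ d) = ∑ᵢ ∑ⱼ (dᵢ - dⱼ)² (dᵢ + dⱼ)`. -/
theorem sum_sq_mul_sum_lt_card_mul_sum_cube {ι : Type*} [Fintype ι] {d : ι → ℚ}
    (hd : ∀ i, 0 ≤ d i) {i j : ι} (hij : d i ≠ d j) :
    (∑ i, d i ^ 2) * ∑ i, d i < Fintype.card ι * ∑ i, d i ^ 3 := by
  have hs : ∑ i, ∑ j, (d i - d j) ^ 2 * (d i + d j) =
      2 * (Fintype.card ι * ∑ i, d i ^ 3 - (∑ i, d i ^ 2) * ∑ i, d i) := by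
    have h1 : ∀ i j, (d i - d j) ^ 2 * (d i + d j) =
        d i ^ 3 + d j ^ 3 - d i ^ 2 * d j - d i * d j ^ 2 := fun i j => by ring
    simp only [h1, Finset.sum_sub_distrib, Finset.sum_add_distrib, ← Finset.mul_sum,
      ← Finset.sum_mul, Finset.sum_const, Finset.card_univ, nsmul_eq_mul]
    ring
  have hn : ∀ i j, 0 ≤ (d i - d j) ^ 2 * (d i + d j) := fun i j =>
    mul_nonneg (sq_nonneg _) (add_nonneg (hd i) (hd j))
  have hpos : 0 < ∑ i, ∑ j, (d i - d j) ^ 2 * (d i + d j) := by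
    refine Finset.sum_pos' (fun i _ => Finset.sum_nonneg fun j _ => hn i j)
      ⟨i, Finset.mem_univ _, Finset.sum_pos' (fun j _ => hn i j) ⟨j, Finset.mem_univ _, ?_⟩⟩
    refine mul_pos (by have := sub_ne_zero.2 hij; positivity) ?_
    rcases (hd i).lt_or_eq with h | h
    · exact add_pos_of_pos_of_nonneg h (hd j)
    · exact add_pos_of_nonneg_of_pos (hd i) ((hd j).lt_of_ne fun h' => hij (h.symm.trans h'))
  linarith

open Classical in
/-- The Hansen–Vukičević inequality is strict for a graph in which adjacent vertices have equal
degrees but which is not regular. -/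
theorem hansen_vukicevic_strict [Fintype V] {Γ : SimpleGraph V}
    (h : ∀ u v, Γ.Adj u v → Γ.degree u = Γ.degree v) {a b : V} (hab : Γ.degree a ≠ Γ.degree b) :
    0 < Fintype.card V ∧ 0 < Γ.edgeSet.ncard ∧
      (secondZagreb Γ : ℚ) / (Γ.edgeSet.ncard : ℚ) >
        (firstZagreb Γ : ℚ) / (Fintype.card V : ℚ) := by
  have hV : 0 < Fintype.card V := Fintype.card_pos_iff.2 ⟨a⟩
  have hncard : Γ.edgeSet.ncard = Γ.edgeFinset.card := by
    rw [← SimpleGraph.coe_edgeFinset, Set.ncard_coe_finset]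
  have he : ∑ v, Γ.degree v = 2 * Γ.edgeSet.ncard := by
    rw [hncard, Γ.sum_degrees_eq_twice_card_edges]
  have hE : 0 < Γ.edgeSet.ncard := by
    by_contra h0
    have h0 : ∑ v, Γ.degree v = 0 := by omega
    rw [Finset.sum_eq_zero_iff] at h0
    exact hab ((h0 a (Finset.mem_univ _)).trans (h0 b (Finset.mem_univ _)).symm)
  refine ⟨hV, hE, ?_⟩
  have key := sum_sq_mul_sum_lt_card_mul_sum_cube (d := fun v => (Γ.degree v : ℚ))
    (fun _ => Nat.cast_nonneg _) (i := a) (j := b) (by exact_mod_cast hab)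
  have h2 : (2 * secondZagreb Γ : ℚ) = ∑ v, (Γ.degree v : ℚ) ^ 3 := by
    exact_mod_cast two_mul_secondZagreb_eq_sum h
  have h1 : (firstZagreb Γ : ℚ) = ∑ v, (Γ.degree v : ℚ) ^ 2 := by
    rw [firstZagreb]; push_cast; rfl
  have h0 : ∑ v, (Γ.degree v : ℚ) = 2 * (Γ.edgeSet.ncard : ℚ) := by exact_mod_cast he
  rw [← h2, ← h1, h0] at key
  rw [gt_iff_lt, div_lt_div_iff₀ (by exact_mod_cast hV) (by exact_mod_cast hE)]
  linarith

theorem copiesOfComplete_adj {l n : ℕ} {x y : Fin l × Fin n} :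
    (copiesOfComplete l n).Adj x y ↔ x ≠ y ∧ x.1 = y.1 := by
  simp only [copiesOfComplete, ne_eq, Prod.ext_iff]
  tauto

/-- A map whose fibres all have `n` elements is, up to bijections, a projection from a product. -/
theorem exists_equiv_prod_of_card_fiber [Finite V] {ι : Type*} [Finite ι] (g : V → ι) {l n : ℕ}
    (hl : Nat.card ι = l) (hg : ∀ i, Nat.card {v // g v = i} = n) :
    ∃ e : V ≃ Fin l × Fin n, ∀ u v, (e u).1 = (e v).1 ↔ g u = g v := by
  have e' : ∀ i, {v // g v = i} ≃ Fin n := fun i => Finite.equivFinOfCardEq (hg i)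
  refine ⟨((Equiv.sigmaFiberEquiv g).symm.trans (Equiv.sigmaEquivProdOfEquiv e')).trans
    ((Finite.equivFinOfCardEq hl).prodCongr (Equiv.refl _)), fun u v => ?_⟩
  simp [Equiv.sigmaFiberEquiv, Equiv.sigmaEquivProdOfEquiv]

/-- A graph whose adjacency is an equivalence relation (off the diagonal), with one class `c` of size
`m` and all other classes of size `n`, is `K_m ⊔ k K_n`, where `k` is the number of classes other
than `c`. -/
theorem nonempty_iso_copiesOfComplete_sum [Finite V] {Γ : SimpleGraph V} {s : Setoid V}
    (hΓ : ∀ u v, Γ.Adj u v ↔ u ≠ v ∧ s u v) (c : Quotient s) {m n : ℕ}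
    (hm : Nat.card {v : V // (⟦v⟧ : Quotient s) = c} = m)
    (hn : ∀ d : Quotient s, d ≠ c → Nat.card {v : V // (⟦v⟧ : Quotient s) = d} = n) :
    Nonempty (Γ ≃g copiesOfComplete 1 m ⊕g
      copiesOfComplete (Nat.card {d : Quotient s // d ≠ c}) n) ∧
    Nat.card {v : V // (⟦v⟧ : Quotient s) ≠ c} = Nat.card {d : Quotient s // d ≠ c} * n := by
  classical
  obtain ⟨e₁, he₁⟩ := exists_equiv_prod_of_card_fiber (n := m)
    (fun _ : {v : V // (⟦v⟧ : Quotient s) = c} => ()) Nat.card_unique (fun i => by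
      rw [← hm]; exact Nat.card_congr (Equiv.subtypeUnivEquiv fun _ => rfl))
  obtain ⟨e₂, he₂⟩ := exists_equiv_prod_of_card_fiber (n := n)
    (fun v : {v : V // (⟦v⟧ : Quotient s) ≠ c} => (⟨⟦v.1⟧, v.2⟩ : {d : Quotient s // d ≠ c}))
    rfl (fun d => by
      rw [← hn d.1 d.2]
      exact Nat.card_congr
        { toFun := fun v => ⟨v.1.1, congrArg Subtype.val v.2⟩
          invFun := fun v => ⟨⟨v.1, fun h => d.2 (v.2.symm.trans h)⟩, Subtype.ext v.2⟩
          left_inv := fun _ => rfl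
          right_inv := fun _ => rfl })
  refine ⟨⟨⟨(Equiv.sumCompl fun v : V => (⟦v⟧ : Quotient s) = c).symm.trans (e₁.sumCongr e₂),
    fun {u v} => ?_⟩⟩, ?_⟩
  · rw [hΓ, ← @Quotient.eq _ s]
    by_cases hu : (⟦u⟧ : Quotient s) = c <;> by_cases hv : (⟦v⟧ : Quotient s) = c
    · simp [Equiv.sumCompl, hu, hv, copiesOfComplete_adj, he₁]
    · simp [Equiv.sumCompl, hu, hv, Ne.symm hv]
    · simp [Equiv.sumCompl, hu, hv]
    · simp [Equiv.sumCompl, hu, hv, copiesOfComplete_adj, he₂]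
  · rw [Nat.card_congr e₂]; simp

open Classical in
theorem degree_add_one_eq_card_class [Fintype V] {Γ : SimpleGraph V} {s : Setoid V}
    (hΓ : ∀ u v, Γ.Adj u v ↔ u ≠ v ∧ s u v) (v : V) :
    Γ.degree v + 1 = Nat.card {u : V // (⟦u⟧ : Quotient s) = ⟦v⟧} := by
  rw [← SimpleGraph.card_neighborFinset_eq_degree, ← Finset.card_insert_of_notMem
    (a := v) (s := Γ.neighborFinset v) (by simp), Nat.card_eq_fintype_card, Fintype.card_subtype]
  congr 1
  ext u
  have : s v u ↔ s u v := ⟨s.symm, s.symm⟩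
  by_cases huv : u = v
  · simp [huv]
  · simp [huv, hΓ, Ne.symm huv, this, Quotient.eq]

end GraphTheory

/-! ### Components of the commuting conjugacy class graph -/

section ClassGraph

open Subgroup

variable {G : Type*} [Group G]

theorem card_subgroup_sdiff [Finite G] {H K : Subgroup G} (h : H ≤ K) :
    Nat.card {x // x ∈ K ∧ x ∉ H} = Nat.card K - Nat.card H :=
  Set.ncard_sdiff h

theorem card_carrier_mul_card_centralizer [Finite G] {c : ConjClasses G} {x : G}
    (hx : x ∈ c.carrier) : Nat.card c.carrier * Nat.card (centralizer {x}) = Nat.card G := by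
  rw [ConjClasses.mem_carrier_iff_mk_eq] at hx
  subst hx
  rw [nat_card_centralizer_nat_card_stabilizer, ← ConjAct.orbit_eq_carrier_conjClasses]
  have := Nat.card_congr (MulAction.orbitProdStabilizerEquivGroup (ConjAct G) x)
  rw [Nat.card_prod] at this
  exact this

/-- The number of vertices in a set `S`, computed from the number of group elements lying in these
vertices, when all these elements have centralizers of the same order. -/
theorem card_vertices_mul_card [Finite G] {S : NoncentralClass G → Prop} {K : ℕ}
    (hK : ∀ v, S v → ∀ x ∈ v.1.carrier, Nat.card (centralizer {x}) = K) :
    Nat.card {v // S v} * Nat.card G = Nat.card {x : G // ∃ v, S v ∧ x ∈ v.1.carrier} * K := by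
  let e : {x : G // ∃ v, S v ∧ x ∈ v.1.carrier} ≃ Σ v : {v // S v}, v.1.1.carrier :=
    { toFun := fun x => ⟨⟨⟨ConjClasses.mk x.1, by
          obtain ⟨v, -, hv⟩ := x.2
          rw [ConjClasses.mem_carrier_iff_mk_eq.1 hv]; exact v.2⟩, by
          obtain ⟨v, hS, hv⟩ := x.2
          have h : ∀ hc, (⟨ConjClasses.mk x.1, hc⟩ : NoncentralClass G) = v := fun _ =>
            Subtype.ext (ConjClasses.mem_carrier_iff_mk_eq.1 hv)
          rw [h]
          exact hS⟩, x.1, ConjClasses.mem_carrier_mk⟩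
      invFun := fun y => ⟨y.2.1, y.1.1, y.1.2, y.2.2⟩
      left_inv := fun _ => rfl
      right_inv := by
        rintro ⟨⟨⟨c, hc⟩, hS⟩, x, hx⟩
        obtain rfl := ConjClasses.mem_carrier_iff_mk_eq.1 hx
        rfl }
  have : Fintype {v // S v} := Fintype.ofFinite _
  rw [Nat.card_congr e, Nat.card_sigma, Finset.sum_mul, Finset.sum_congr rfl
    (g := fun _ => Nat.card G), Finset.sum_const, Finset.card_univ, smul_eq_mul,
    Nat.card_eq_fintype_card]
  rintro v -
  obtain ⟨x, hx⟩ : ∃ x, x ∈ v.1.1.carrier := by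
    obtain ⟨x, -, hx⟩ := v.1.2
    exact ⟨x, ConjClasses.mem_carrier_iff_mk_eq.2 hx⟩
  rw [← hK v.1 v.2 x hx, card_carrier_mul_card_centralizer hx]

/-- The vertex of the commuting conjugacy class graph given by a non-central element. -/
def NoncentralClass.of (x : G) (hx : x ∉ center G) : NoncentralClass G :=
  ⟨ConjClasses.mk x, x, hx, rfl⟩

theorem NoncentralClass.mem_carrier_iff {v : NoncentralClass G} {x : G} :
    x ∈ v.1.carrier ↔ ∃ hx : x ∉ center G, NoncentralClass.of x hx = v := by
  rw [ConjClasses.mem_carrier_iff_mk_eq]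
  refine ⟨fun h => ⟨fun hx => ?_, Subtype.ext h⟩, fun ⟨hx, h⟩ => congrArg Subtype.val h⟩
  obtain ⟨y, hy, hyv⟩ := v.2
  rw [← hyv, ConjClasses.mk_eq_mk_iff_isConj, isConj_iff] at h
  obtain ⟨g, rfl⟩ := h
  exact hy ((inferInstance : (center G).Normal).conj_mem _ hx g)

variable [Finite G] {p : ℕ} (hp : p.Prime) (hcard : Nat.card (G ⧸ center G) = p ^ 3)

/-- Containing commuting elements is an equivalence relation on the non-central classes, because
commuting is transitive on non-central elements. -/
def commutingSetoid : Setoid (NoncentralClass G) where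
  r u v := ∃ x ∈ u.1.carrier, ∃ y ∈ v.1.carrier, x * y = y * x
  iseqv := by
    refine ⟨fun u => ?_, fun ⟨x, hx, y, hy, h⟩ => ⟨y, hy, x, hx, h.symm⟩, ?_⟩
    · obtain ⟨x, -, hx⟩ := u.2
      have := ConjClasses.mem_carrier_iff_mk_eq.2 hx
      exact ⟨x, this, x, this, rfl⟩
    · rintro u v w ⟨x, hx, y, hy, h⟩ ⟨y', hy', z, hz, h'⟩
      obtain ⟨hyZ', -⟩ := NoncentralClass.mem_carrier_iff.1 hy'
      rw [ConjClasses.mem_carrier_iff_mk_eq] at hx hy hy'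
      obtain ⟨g, rfl⟩ := isConj_iff.1 (ConjClasses.mk_eq_mk_iff_isConj.1 (hy.trans hy'.symm))
      refine ⟨g * x * g⁻¹, ?_, z, hz, commute_of_mem_centralizer hp hcard hyZ' ?_ ?_⟩
      · rw [ConjClasses.mem_carrier_iff_mk_eq, ← hx, ConjClasses.mk_eq_mk_iff_isConj, isConj_comm]
        exact isConj_iff.2 ⟨g, rfl⟩
      · rw [mem_centralizer_singleton_iff]
        simp only [mul_assoc, inv_mul_cancel_left, mul_right_inj]
        simp only [← mul_assoc, h]
      · exact mem_centralizer_singleton_iff.2 h'.symm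

theorem CCC_adj_iff (u v : NoncentralClass G) :
    (CCC G).Adj u v ↔ u ≠ v ∧ commutingSetoid hp hcard u v := Iff.rfl

theorem commutingSetoid_of_iff {x y : G} (hx : x ∉ center G) (hy : y ∉ center G) :
    commutingSetoid hp hcard (NoncentralClass.of x hx) (NoncentralClass.of y hy) ↔
      ∃ g, g * x * g⁻¹ ∈ centralizer {y} := by
  constructor
  · rintro ⟨a, ha, b, hb, h⟩
    obtain ⟨g, rfl⟩ := isConj_iff.1 (ConjClasses.mk_eq_mk_iff_isConj.1
      (ConjClasses.mem_carrier_iff_mk_eq.1 ha).symm)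
    obtain ⟨k, rfl⟩ := isConj_iff.1 (ConjClasses.mk_eq_mk_iff_isConj.1
      (ConjClasses.mem_carrier_iff_mk_eq.1 hb).symm)
    refine ⟨k⁻¹ * g, mem_centralizer_singleton_iff.2 ?_⟩
    have h' := congrArg (fun z => k⁻¹ * z * k) h
    simpa [mul_assoc] using h'
  · rintro ⟨g, hg⟩
    refine ⟨g * x * g⁻¹, ?_, y, ConjClasses.mem_carrier_mk, mem_centralizer_singleton_iff.1 hg⟩
    rw [ConjClasses.mem_carrier_iff_mk_eq]
    exact ConjClasses.mk_eq_mk_iff_isConj.2 (isConj_comm.1 (isConj_iff.2 ⟨g, rfl⟩))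

/-- The group elements lying in the vertices of a union `P` of components. -/
theorem exists_mem_class_iff {P : Quotient (commutingSetoid hp hcard) → Prop} {x : G} :
    (∃ v : NoncentralClass G, P ⟦v⟧ ∧ x ∈ v.1.carrier) ↔
      ∃ hx : x ∉ center G, P ⟦NoncentralClass.of x hx⟧ := by
  constructor
  · rintro ⟨v, hv, hx⟩
    obtain ⟨hxZ, rfl⟩ := NoncentralClass.mem_carrier_iff.1 hx
    exact ⟨hxZ, hv⟩
  · rintro ⟨hx, h⟩
    exact ⟨_, h, NoncentralClass.mem_carrier_iff.2 ⟨hx, rfl⟩⟩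

variable (hnonab : ¬ ∀ a b : G ⧸ center G, a * b = b * a)
  {t : G} (ht : t ∈ secondCenter G) (htZ : t ∉ center G)
include hnonab ht

/-- The component of the class of `t` consists of the classes of elements of `C(t)`, as this subgroup
is normal. -/
theorem mem_special_class_iff {x : G} (hx : x ∉ center G) :
    (⟦NoncentralClass.of x hx⟧ : Quotient (commutingSetoid hp hcard)) = ⟦NoncentralClass.of t htZ⟧ ↔
      x ∈ centralizer {t} := by
  have hn := normal_of_secondCenter_le hp hcard hnonab
    (secondCenter_le_centralizer hp hcard hnonab ht htZ)
  rw [Quotient.eq, commutingSetoid_of_iff]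
  refine ⟨fun ⟨g, hg⟩ => ?_, fun h => ⟨1, by simpa using h⟩⟩
  simpa [mul_assoc] using hn.conj_mem _ hg g⁻¹

/-- The number of vertices in the component of `t`, cleared of denominators: all the elements of
`C(t) \ Z(G)` have the same centralizer. -/
theorem card_special_class_mul :
    Nat.card {v : NoncentralClass G // (⟦v⟧ : Quotient (commutingSetoid hp hcard)) =
        ⟦NoncentralClass.of t htZ⟧} * Nat.card G =
      (Nat.card (centralizer {t}) - Nat.card (center G)) * Nat.card (centralizer {t}) := by
  rw [card_vertices_mul_card (K := Nat.card (centralizer {t}))]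
  · rw [← card_subgroup_sdiff (center_le_centralizer_singleton t)]
    congr 1
    refine Nat.card_congr (Equiv.subtypeEquivRight fun x => ?_)
    rw [exists_mem_class_iff hp hcard (P := fun d => d = _)]
    exact ⟨fun ⟨hx, h⟩ => ⟨(mem_special_class_iff hp hcard hnonab ht htZ hx).1 h, hx⟩,
      fun ⟨h, hx⟩ => ⟨hx, (mem_special_class_iff hp hcard hnonab ht htZ hx).2 h⟩⟩
  · intro v hv x hx
    obtain ⟨hxZ, rfl⟩ := NoncentralClass.mem_carrier_iff.1 hx
    have h := (mem_special_class_iff hp hcard hnonab ht htZ hxZ).1 hv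
    rw [mem_centralizer_singleton_iff] at h
    congr 2
    ext a
    exact ⟨fun ha => mem_centralizer_singleton_iff.2 (commute_of_mem_centralizer hp hcard hxZ ha
        (mem_centralizer_singleton_iff.2 h.symm)),
      fun ha => mem_centralizer_singleton_iff.2 (commute_of_mem_centralizer hp hcard htZ ha
        (mem_centralizer_singleton_iff.2 h))⟩

/-- The number of vertices outside the component of `t`, cleared of denominators. -/
theorem card_other_vertices_mul :
    Nat.card {v : NoncentralClass G // (⟦v⟧ : Quotient (commutingSetoid hp hcard)) ≠
        ⟦NoncentralClass.of t htZ⟧} * Nat.card G =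
      (Nat.card G - Nat.card (centralizer {t})) * (p * Nat.card (center G)) := by
  rw [card_vertices_mul_card (K := p * Nat.card (center G))]
  · rw [← card_top (G := G), ← card_subgroup_sdiff (le_top : centralizer {t} ≤ ⊤)]
    congr 1
    refine Nat.card_congr (Equiv.subtypeEquivRight fun x => ?_)
    rw [exists_mem_class_iff hp hcard (P := fun d => d ≠ _)]
    exact ⟨fun ⟨hx, h⟩ => ⟨mem_top x, mt (mem_special_class_iff hp hcard hnonab ht htZ hx).2 h⟩,
      fun ⟨_, h⟩ => ⟨fun hx => h (center_le_centralizer_singleton t hx),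
        mt (mem_special_class_iff hp hcard hnonab ht htZ _).1 h⟩⟩
  · intro v hv x hx
    obtain ⟨hxZ, rfl⟩ := NoncentralClass.mem_carrier_iff.1 hx
    exact (card_centralizer_of_notMem hp hcard hnonab ht htZ
      (mt (mem_special_class_iff hp hcard hnonab ht htZ hxZ).2 hv)).1

/-- Every component other than that of `t` has `|Z(G)| (p - 1) / p` vertices. -/
theorem mul_card_other_class {d : Quotient (commutingSetoid hp hcard)}
    (hd : d ≠ ⟦NoncentralClass.of t htZ⟧) :
    p * Nat.card {v : NoncentralClass G // (⟦v⟧ : Quotient (commutingSetoid hp hcard)) = d} =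
      (p - 1) * Nat.card (center G) := by
  obtain ⟨v, rfl⟩ := Quotient.exists_rep d
  obtain ⟨y, hyv⟩ : ∃ y, y ∈ v.1.carrier := by
    obtain ⟨x, -, hx⟩ := v.2
    exact ⟨x, ConjClasses.mem_carrier_iff_mk_eq.2 hx⟩
  obtain ⟨hyZ, rfl⟩ := NoncentralClass.mem_carrier_iff.1 hyv
  have hy := mt (mem_special_class_iff hp hcard hnonab ht htZ hyZ).2 hd
  have h := card_vertices_mul_card (K := p * Nat.card (center G))
    (S := fun v => (⟦v⟧ : Quotient (commutingSetoid hp hcard)) = ⟦NoncentralClass.of y hyZ⟧) (by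
      intro v hv x hx
      obtain ⟨hxZ, rfl⟩ := NoncentralClass.mem_carrier_iff.1 hx
      exact (card_centralizer_of_notMem hp hcard hnonab ht htZ
        (mt (mem_special_class_iff hp hcard hnonab ht htZ hxZ).2 (hv ▸ hd))).1)
  have h2 : Nat.card {x : G // ∃ v : NoncentralClass G,
      (⟦v⟧ : Quotient (commutingSetoid hp hcard)) = ⟦NoncentralClass.of y hyZ⟧ ∧
        x ∈ v.1.carrier} = p ^ 2 * Nat.card (center G) - p * Nat.card (center G) := by
    rw [← (card_centralizer_of_notMem hp hcard hnonab ht htZ hy).2,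
      ← card_secondCenter hp hcard hnonab,
      ← card_subgroup_sdiff (secondCenter_le_centralizerModCenter y)]
    refine Nat.card_congr (Equiv.subtypeEquivRight fun x => ?_)
    rw [exists_mem_class_iff hp hcard (P := fun d => d = _),
      ← exists_conj_mem_centralizer_iff hp hcard hnonab ht htZ hy]
    simp only [Quotient.eq, commutingSetoid_of_iff, exists_prop]
  rw [h2, card_eq_pow_three_mul_card_center hcard] at h
  have hx : 0 < Nat.card (center G) := Nat.card_pos
  refine Nat.eq_of_mul_eq_mul_left
    (show 0 < p ^ 2 * Nat.card (center G) from Nat.mul_pos (pow_pos hp.pos 2) hx) ?_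
  obtain ⟨q, rfl⟩ : ∃ q, p = q + 1 := ⟨p - 1, by have := hp.pos; omega⟩
  have h3 : (q + 1) ^ 2 * Nat.card (center G) - (q + 1) * Nat.card (center G) =
      q * (q + 1) * Nat.card (center G) :=
    Nat.sub_eq_of_eq_add (by ring)
  rw [h3] at h
  rw [Nat.add_sub_cancel]
  linarith

end ClassGraph

/-! ### Structure of the graph and the inequality -/

theorem mainTheorem3 {G : Type*} [Group G] [Finite G] (p : ℕ) (hp : p.Prime)
    (hcard : Nat.card (G ⧸ Subgroup.center G) = p ^ 3)
    (hnonab : ¬ ∀ a b : G ⧸ Subgroup.center G, a * b = b * a) :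
    -- the structure of the graph, with `x = |Z(G)|`
    ((∃ k m n₁ n₂ : ℕ, 1 ≤ k ∧ k ≤ p ∧
        (m : ℚ) = (Nat.card (Subgroup.center G) : ℚ) * ((p : ℚ) ^ 2 - 1) / p ∧
        (n₁ : ℚ) = (Nat.card (Subgroup.center G) : ℚ) * ((p : ℚ) - 1) / (p : ℚ) ^ 2 ∧
        (n₂ : ℚ) = (Nat.card (Subgroup.center G) : ℚ) * ((p : ℚ) - 1) / p ∧
        Nonempty (CCC G ≃g
          ((copiesOfComplete 1 m ⊕g copiesOfComplete (k * p) n₁) ⊕g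
            copiesOfComplete (p - k) n₂))) ∨
      (∃ k n₁ n₂ : ℕ, 1 ≤ k ∧ k ≤ p ∧
        (n₁ : ℚ) = (Nat.card (Subgroup.center G) : ℚ) * ((p : ℚ) - 1) / (p : ℚ) ^ 2 ∧
        (n₂ : ℚ) = (Nat.card (Subgroup.center G) : ℚ) * ((p : ℚ) - 1) / p ∧
        Nonempty (CCC G ≃g
          (copiesOfComplete (k * p + 1) n₁ ⊕g copiesOfComplete (p + 1 - k) n₂))) ∨
      (∃ m n₂ : ℕ,
        (m : ℚ) = (Nat.card (Subgroup.center G) : ℚ) * ((p : ℚ) ^ 2 - 1) / p ∧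
        (n₂ : ℚ) = (Nat.card (Subgroup.center G) : ℚ) * ((p : ℚ) - 1) / p ∧
        Nonempty (CCC G ≃g (copiesOfComplete 1 m ⊕g copiesOfComplete p n₂))) ∨
      (∃ n₁ : ℕ,
        (n₁ : ℚ) = (Nat.card (Subgroup.center G) : ℚ) * ((p : ℚ) - 1) / (p : ℚ) ^ 2 ∧
        Nonempty (CCC G ≃g copiesOfComplete (p ^ 2 + p + 1) n₁)) ∨
      (∃ n₁ n₂ : ℕ,
        (n₁ : ℚ) = (Nat.card (Subgroup.center G) : ℚ) * ((p : ℚ) - 1) / (p : ℚ) ^ 2 ∧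
        (n₂ : ℚ) = (Nat.card (Subgroup.center G) : ℚ) * ((p : ℚ) - 1) / p ∧
        Nonempty (CCC G ≃g (copiesOfComplete 1 n₁ ⊕g copiesOfComplete (p + 1) n₂)))) ∧
    -- the graph has vertices and edges, and the inequality is strict
    0 < Fintype.card (NoncentralClass G) ∧
    0 < (CCC G).edgeSet.ncard ∧
    (secondZagreb (CCC G) : ℚ) / ((CCC G).edgeSet.ncard : ℚ) >
      (firstZagreb (CCC G) : ℚ) / (Fintype.card (NoncentralClass G) : ℚ) := by
  classical
  obtain ⟨-, t, ht, htZ⟩ := SetLike.lt_iff_le_and_exists.1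
    (center_lt_secondCenter hp hcard hnonab)
  have hx : 0 < Nat.card (Subgroup.center G) := Nat.card_pos
  obtain ⟨y, hy⟩ : ∃ y, y ∉ Subgroup.centralizer {t} := by
    by_contra! h
    exact (centralizer_lt_top htZ).ne (eq_top_iff.2 fun y _ => h y)
  have hyZ : y ∉ Subgroup.center G := fun h => hy (center_le_centralizer_singleton t h)
  set c : Quotient (commutingSetoid hp hcard) := ⟦NoncentralClass.of t htZ⟧ with hc
  set d : Quotient (commutingSetoid hp hcard) := ⟦NoncentralClass.of y hyZ⟧ with hd
  have hdc : d ≠ c := mt (mem_special_class_iff hp hcard hnonab ht htZ hyZ).1 hy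
  have hm := card_special_class_mul hp hcard hnonab ht htZ
  have hkn := card_other_vertices_mul hp hcard hnonab ht htZ
  have hn := mul_card_other_class hp hcard hnonab ht htZ hdc
  rw [← hc] at hm hkn
  -- apart from the component of `t`, all components have as many vertices as that of `y`
  obtain ⟨⟨e⟩, hk⟩ := nonempty_iso_copiesOfComplete_sum (CCC_adj_iff hp hcard) c rfl
    (n := Nat.card {v : NoncentralClass G // (⟦v⟧ : Quotient (commutingSetoid hp hcard)) = d})
    fun d' hd' => Nat.eq_of_mul_eq_mul_left hp.pos
      ((mul_card_other_class hp hcard hnonab ht htZ hd').trans hn.symm)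
  have hdeg := degree_add_one_eq_card_class (CCC_adj_iff hp hcard)
  have hdt := hdeg (NoncentralClass.of t htZ)
  have hdy := hdeg (NoncentralClass.of y hyZ)
  rw [← hc] at hdt
  rw [← hd] at hdy
  rw [hk] at hkn
  set m := Nat.card {v : NoncentralClass G // (⟦v⟧ : Quotient (commutingSetoid hp hcard)) = c}
  set n := Nat.card {v : NoncentralClass G // (⟦v⟧ : Quotient (commutingSetoid hp hcard)) = d}
  set k := Nat.card {d : Quotient (commutingSetoid hp hcard) // d ≠ c}
  -- the centralizer of `t` has order `p |Z(G)|` or `p² |Z(G)|`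
  obtain ⟨i, hi⟩ := exists_card_eq_pow_mul_card_center hp hcard
    (center_le_centralizer_singleton t)
  have hi0 : i ≠ 0 := by
    rintro rfl
    have := mul_card_le_card_of_lt hp hcard le_rfl (center_lt_centralizer htZ)
    rw [hi, pow_zero] at this
    exact absurd hp.one_lt (by have := Nat.le_of_mul_le_mul_right this hx; omega)
  have hi3 : i < 3 := by
    have := mul_card_le_card_of_lt hp hcard (center_le_centralizer_singleton t)
      (centralizer_lt_top htZ)
    rw [Subgroup.card_top, card_eq_pow_three_mul_card_center hcard, hi, ← mul_assoc,
      ← pow_succ'] at this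
    exact (Nat.pow_le_pow_iff_right hp.one_lt).1 (Nat.le_of_mul_le_mul_right this hx)
  rw [card_eq_pow_three_mul_card_center hcard, hi] at hm hkn
  generalize Nat.card (Subgroup.center G) = x at *
  have hle : x ≤ p ^ i * x := Nat.le_mul_of_pos_left x (pow_pos hp.pos i)
  have hle' : p ^ i * x ≤ p ^ 3 * x :=
    Nat.mul_le_mul_right x (Nat.pow_le_pow_right hp.pos hi3.le)
  have hp0 : (p : ℚ) ≠ 0 := by exact_mod_cast hp.ne_zero
  have hp1 : (1 : ℚ) < p := by exact_mod_cast hp.one_lt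
  have hx0 : (0 : ℚ) < x := by exact_mod_cast hx
  have hm' := congrArg (Nat.cast : ℕ → ℚ) hm
  have hkn' := congrArg (Nat.cast : ℕ → ℚ) hkn
  have hn' := congrArg (Nat.cast : ℕ → ℚ) hn
  push_cast [Nat.cast_sub hle, Nat.cast_sub hle', Nat.cast_sub hp.one_le] at hm' hkn' hn'
  have hnp : (n : ℚ) = x * ((p : ℚ) - 1) / p := by
    rw [eq_div_iff hp0]; linarith
  have hn0 : (n : ℚ) ≠ 0 := by
    rw [hnp]; have := sub_pos.2 hp1; positivity
  -- two vertices in the same component have equal degrees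
  have hreg : ∀ u v, (CCC G).Adj u v → (CCC G).degree u = (CCC G).degree v := fun u v huv => by
    have h : (⟦u⟧ : Quotient (commutingSetoid hp hcard)) = ⟦v⟧ :=
      Quotient.eq.2 ((CCC_adj_iff hp hcard u v).1 huv).2
    have h1 := hdeg u
    rw [h, ← hdeg v] at h1
    omega
  have hne : m ≠ n → (CCC G).degree (NoncentralClass.of t htZ) ≠
      (CCC G).degree (NoncentralClass.of y hyZ) := fun h => by omega
  interval_cases i
  · exact absurd rfl hi0
  -- `C(t)` is the second centre: the graph is `K_{n₁} ⊔ (p + 1) K_{n₂}`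
  · have hmp : (m : ℚ) = x * ((p : ℚ) - 1) / (p : ℚ) ^ 2 := by
      rw [eq_div_iff (pow_ne_zero 2 hp0)]
      refine mul_right_cancel₀ (mul_ne_zero hp0 hx0.ne') ?_
      linear_combination hm'
    have hmn : (n : ℚ) = p * m := by
      rw [hnp, hmp]; field_simp
    have hkp : k = p + 1 := by
      have : (k : ℚ) = p + 1 := by
        refine mul_right_cancel₀ (mul_ne_zero hn0 (mul_ne_zero (pow_ne_zero 3 hp0) hx0.ne')) ?_
        linear_combination hkn' - ((p : ℚ) + 1) * p ^ 2 * x * hn'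
      exact_mod_cast this
    rw [hkp] at e
    refine ⟨.inr (.inr (.inr (.inr ⟨m, n, hmp, hnp, ⟨e⟩⟩))),
      hansen_vukicevic_strict hreg (hne fun h => ?_)⟩
    rw [h] at hmn
    exact hp1.ne' (mul_right_cancel₀ hn0 (by linarith))
  -- `C(t)` is larger than the second centre: the graph is `K_m ⊔ p K_{n₂}`
  · have hmp : (m : ℚ) = x * ((p : ℚ) ^ 2 - 1) / p := by
      rw [eq_div_iff hp0]
      refine mul_right_cancel₀ (mul_ne_zero (pow_ne_zero 2 hp0) hx0.ne') ?_
      linear_combination hm'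
    have hmn : (m : ℚ) = (p + 1) * n := by
      rw [hnp, hmp]; field_simp; ring
    have hkp : k = p := by
      have : (k : ℚ) = p := by
        refine mul_right_cancel₀ (mul_ne_zero hn0 (mul_ne_zero (pow_ne_zero 3 hp0) hx0.ne')) ?_
        linear_combination hkn' - (p : ℚ) ^ 3 * x * hn'
      exact_mod_cast this
    rw [hkp] at e
    refine ⟨.inr (.inr (.inl ⟨m, n, hmp, hnp, ⟨e⟩⟩)),
      hansen_vukicevic_strict hreg (hne fun h => ?_)⟩
    rw [h] at hmn
    exact hp0 (mul_right_cancel₀ hn0 (by linarith))
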